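/- Let $M$ be a smooth manifold (without boundary) modelled on a real Banach space $\mathbb E$, with atlas $\{(U_\alpha,\phi_\alpha)\}_{\alpha\in I}$. Put $T^0M=M$, $T^{i+1}M=T(T^iM)$, with projections $\pi_i:T^{i+1}M\to T^iM$, model spaces $\mathbb E_0=\mathbb E$, $\mathbb E_{i+1}=\mathbb E_i\times\mathbb E_i$, and induced charts $\phi_{\alpha_0}=\phi_\alpha$, $\phi_{\alpha_{i+1}}=D\phi_{\alpha_i}$ on $U_{\alpha_{i+1}}=\pi_i^{-1}(U_{\alpha_i})$. For a manifold $N$ let $\kappa_N:TTN\to TTN$ be the canonical involution, locally $(x,y,X,Y)\mapsto(x,X,y,Y)$. A semispray on $N$ is a smooth vector field $S:TN\to TTN$ on $TN$ with $\kappa_N\circ S=S$; in a chart it has the form $(x,y)\mapsto(x,y;\,y,-2G(x,y))$. A semispray on $T^iM$ is a (2-homogeneous) spray if its local components $G_\alpha$ in the charts $\phi_{\alpha_i}$ satisfy $G_\alpha(x,\lambda\xi)=\lambda^2G_\alpha(x,\xi)$ for all $\alpha\in I$, $\lambda\in\mathbb R$, $x\in\phi_{\alpha_i}(U_{\alpha_i})$,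 $\xi\in\mathbb E_i$. The complete lift of a semispray $S$ on $N$ is $S^c=D\kappa_N\circ\kappa_{TN}\circ DS\circ\kappa_N:TTN\to TTTN$; put $S^{c_0}=S$, $S^{c_{i+1}}=(S^{c_i})^c$. Let $T^\infty M=\varprojlim(T^iM,\pi_i)$, $T(T^\infty M)=\varprojlim(T(T^iM),D\pi_i)$, $T^2(T^\infty M)=\varprojlim(T^2(T^iM),D^2\pi_i)$, with the limit charts of the $\phi_{\alpha_i}$, $D\phi_{\alpha_i}$, $D^2\phi_{\alpha_i}$, which take values in $\mathbb E_\infty$, $\mathbb E_\infty^2$, $\mathbb E_\infty^4$, where $\mathbb E_\infty=\varprojlim\mathbb E_i$ is the limit along $(x,y)\mapsto x$; let $U_\alpha^\infty\subseteq\mathbb E_\infty$ be the image of the limit chart of $T^\infty M$. Let $\pi_{T(T^\infty M)}$ be the limit of the projections $T^2(T^iM)\to T(T^iM)$ and $D\pi_{T^\infty M}:T^2(T^\infty M)\to T(T^\infty M)$ the limit of the tangent maps of the projections $T(T^iM)\to T^iM$. A semispray on $T^\infty M$ is a smooth map $S:T(T^\infty M)\to T^2(T^\infty M)$ (continuous,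 and with local representations of class $C^n$ for all $n$ in the sense of Michal-Bastiani/Hamilton) with $\pi_{T(T^\infty M)}\circ S=\mathrm{id}$ and $D\pi_{T^\infty M}\circ S=\mathrm{id}$; it is a spray if its local components $G_\alpha$ (with $S_\alpha(x,y)=(x,y;y,-2G_\alpha(x,y))$) satisfy $G_\alpha(x,\lambda y)=\lambda^2G_\alpha(x,y)$ for all $\alpha\in I$, $\lambda\in\mathbb R$, $x\in U_\alpha^\infty$, $y\in\mathbb E_\infty$. **Proposition.** (i) For every $i\ge 0$, if $S$ is a spray on $T^iM$, then $S^c$ is a spray on $T^{i+1}M$. (ii) If $S$ is a spray on $M$, then the $S^{c_i}$ form a projective system, $D^2\pi_i\circ S^{c_{i+1}}=S^{c_i}\circ D\pi_i$ for all $i\ge0$, and the limit $S^{c_\infty}=\varprojlim S^{c_i}:T(T^\infty M)\to T^2(T^\infty M)$ is a spray on $T^\infty M$. Its local representation is $(x,y)\mapsto(x,y;\,y,-2G^\infty_\alpha(x,y))$ on $U_\alpha^\infty\times\mathbb E_\infty$, where $G_\alpha^\infty=\varprojlim G_\alpha^i$ is the limit of the local components $G^i_\alpha$ of the $S^{c_i}$,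 that is $G^\infty_\alpha(x,y)_i=G^i_\alpha(x_i,y_i)$ for all $i$, and $G_\alpha^\infty$ is 2-homogeneous in $y$. -/

import Mathlib

open Set Filter Topology Manifold
open scoped ContDiff

set_option linter.checkUnivs false

universe u v w w'

/-- A smooth manifold without boundary modelled on a real Banach space `Vec`, bundled so that
iterated tangent bundles can be formed by recursion. The model `I` identifies `Model` with the
whole of `Vec`; for a manifold charted directly on a Banach space `E`, take `Model = E` and
`I = 𝓘(ℝ, E)`. -/
structure BanachManifold : Type (max (u + 1) (v + 1)) where
  Carrier : Type (max u v)
  Model : Type v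
  Vec : Type v
  [normedVec : NormedAddCommGroup Vec]
  [spaceVec : NormedSpace ℝ Vec]
  [completeVec : CompleteSpace Vec]
  [topModel : TopologicalSpace Model]
  I : ModelWithCorners ℝ Vec Model
  [boundaryless : I.Boundaryless]
  [topCarrier : TopologicalSpace Carrier]
  [charted : ChartedSpace Model Carrier]
  [smooth : IsManifold I ∞ Carrier]

namespace BanachManifold

attribute [instance] normedVec spaceVec completeVec topModel boundaryless topCarrier charted smooth

/-! ### Iterated tangent bundles -/

/-- The tangent bundle `TN`, modelled on `Vec × Vec`. -/
noncomputable abbrev tangent (N : BanachManifold.{u, v}) : BanachManifold.{u, v} where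
  Carrier := TangentBundle N.I N.Carrier
  Model := ModelProd N.Model N.Vec
  Vec := N.Vec × N.Vec
  I := N.I.tangent

/-- The iterated tangent bundle `TⁱM`, with `T⁰M = M` and `Tⁱ⁺¹M = T(TⁱM)`. -/
noncomputable def iter (M : BanachManifold.{u, v}) : ℕ → BanachManifold.{u, v}
  | 0 => M
  | i + 1 => (M.iter i).tangent

/-- The canonical projection `TN → N`. -/
def proj (N : BanachManifold.{u, v}) : N.tangent.Carrier → N.Carrier := fun w => w.1

/-- The tangent map `Df : TN → TN'` of `f : N → N'`. -/
noncomputable def D {N N' : BanachManifold.{u, v}} (f : N.Carrier → N'.Carrier) :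
    N.tangent.Carrier → N'.tangent.Carrier := tangentMap N.I N'.I f

/-- `(x, y, X, Y) ↦ (x, X, y, Y)`. -/
def swapMiddle (E : Type v) : (E × E) × (E × E) → (E × E) × (E × E) :=
  fun p => ((p.1.1, p.2.1), (p.1.2, p.2.2))

/-- The canonical involution `κ : TTN → TTN`, given in coordinates by `(x, y, X, Y) ↦ (x, X, y, Y)`.
At `w` the coordinates are those of the preferred chart of `TTN` at `w`, which is the second
tangent map of the preferred chart of `N` at the base point of `w`. -/
noncomputable def involution (N : BanachManifold.{u, v}) :
    N.tangent.tangent.Carrier → N.tangent.tangent.Carrier := fun w =>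
  (extChartAt N.tangent.tangent.I w).symm (swapMiddle N.Vec (extChartAt N.tangent.tangent.I w w))

/-! ### Induced charts -/

/-- A chart of `N` with values in the Banach space `Vec`. -/
noncomputable def coord (N : BanachManifold.{u, v}) (e : atlas N.Model N.Carrier) :
    PartialEquiv N.Carrier N.Vec := e.1.extend N.I

/-- The chart `De` of `TN` induced by a chart `e` of `N`, that is `w ↦ (e x, De(x) w)` for
`w ∈ T_x N`. -/
noncomputable def tangentChart (N : BanachManifold.{u, v}) (e : atlas N.Model N.Carrier) :
    atlas N.tangent.Model N.tangent.Carrier :=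
  ⟨((tangentBundleCore N.I N.Carrier).localTriv e).toOpenPartialHomeomorph ≫ₕ
      e.1.prod (OpenPartialHomeomorph.refl N.Vec),
    ⟨_, ⟨_, ⟨⟨e, rfl⟩, rfl⟩⟩, _, ⟨e.1, e.2, _, rfl, rfl⟩, rfl⟩⟩

/-- The chart `φ_{αᵢ}` of `TⁱM` induced by a chart `α` of `M`. -/
noncomputable def iterChart (M : BanachManifold.{u, v}) (α : atlas M.Model M.Carrier) :
    ∀ i : ℕ, atlas (M.iter i).Model (M.iter i).Carrier
  | 0 => α
  | i + 1 => (M.iter i).tangentChart (M.iterChart α i)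

/-! ### Semisprays, sprays and complete lifts on Banach manifolds -/

/-- A semispray on `N`: a smooth vector field `S : TN → TTN` on `TN` with `κ ∘ S = S`. -/
structure IsSemispray (N : BanachManifold.{u, v})
    (S : N.tangent.Carrier → N.tangent.tangent.Carrier) : Prop where
  smooth : ContMDiff N.tangent.I N.tangent.tangent.I ∞ S
  proj_eq : ∀ ξ, N.tangent.proj (S ξ) = ξ
  involution_eq : ∀ ξ, N.involution (S ξ) = S ξ

/-- The local component `G_e` of a semispray `S` in the chart `e`, that is
`S_e (x, y) = (x, y; y, -2 G_e (x, y))` for the local representation `S_e` of `S`. -/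
noncomputable def localComponent (N : BanachManifold.{u, v}) (e : atlas N.Model N.Carrier)
    (S : N.tangent.Carrier → N.tangent.tangent.Carrier) : N.Vec × N.Vec → N.Vec := fun p =>
  (-1 / 2 : ℝ) • (N.tangent.tangent.coord (N.tangent.tangentChart (N.tangentChart e))
    (S ((N.tangent.coord (N.tangentChart e)).symm p))).2.2

/-- A (2-homogeneous) spray on `TⁱM`: a semispray all of whose local components, in the charts of
`TⁱM` induced by the atlas of `M`, are 2-homogeneous. -/
structure IsSpray (M : BanachManifold.{u, v}) (i : ℕ)
    (S : (M.iter i).tangent.Carrier → (M.iter i).tangent.tangent.Carrier) : Prop where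
  semispray : (M.iter i).IsSemispray S
  homogeneous : ∀ (α : atlas M.Model M.Carrier),
    ∀ x ∈ ((M.iter i).coord (M.iterChart α i)).target, ∀ (ξ : (M.iter i).Vec) (c : ℝ),
      (M.iter i).localComponent (M.iterChart α i) S (x, c • ξ) =
        c ^ 2 • (M.iter i).localComponent (M.iterChart α i) S (x, ξ)

/-- The complete lift `S^c = Dκ ∘ κ ∘ DS ∘ κ` of a vector field `S` on `TN`, a vector field
on `TTN`. -/
noncomputable def completeLift (N : BanachManifold.{u, v})
    (S : N.tangent.Carrier → N.tangent.tangent.Carrier) :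
    N.tangent.tangent.Carrier → N.tangent.tangent.tangent.Carrier :=
  D (N := N.tangent.tangent) (N' := N.tangent.tangent) N.involution ∘ N.tangent.involution ∘
    D (N := N.tangent) (N' := N.tangent.tangent) S ∘ N.involution

/-- The iterated complete lifts `S^{c₀} = S` and `S^{cᵢ₊₁} = (S^{cᵢ})^c`. -/
noncomputable def iterLift (M : BanachManifold.{u, v})
    (S : M.tangent.Carrier → M.tangent.tangent.Carrier) :
    ∀ i : ℕ, (M.iter i).tangent.Carrier → (M.iter i).tangent.tangent.Carrier
  | 0 => S
  | i + 1 => (M.iter i).completeLift (M.iterLift S i)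

end BanachManifold

/-! ### Projective limits of sequences -/

/-- The projective limit of a sequence of sets `X i` with connecting maps `f i`. -/
abbrev ProjLim (X : ℕ → Type w) (f : ∀ i, X (i + 1) → X i) : Type w :=
  {x : ∀ i, X i // ∀ i, f i (x (i + 1)) = x i}

namespace ProjLim

variable {X : ℕ → Type w} {f : ∀ i, X (i + 1) → X i} {Y : ℕ → Type w'} {g : ∀ i, Y (i + 1) → Y i}

/-- The limit of a projective system of maps. -/
def map (h : ∀ i, X i → Y i) (hh : ∀ i x, g i (h (i + 1) x) = h i (f i x)) :
    ProjLim X f → ProjLim Y g :=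
  fun x => ⟨fun i => h i (x.1 i), fun i => by rw [hh, x.2]⟩

open scoped Classical in
/-- The limit of a projective system of charts. -/
noncomputable def chart (e : ∀ i, PartialEquiv (X i) (Y i))
    (he : ∀ i, ∀ x ∈ (e (i + 1)).source, f i x ∈ (e i).source ∧ e i (f i x) = g i (e (i + 1) x))
    (hX : Nonempty (ProjLim X f)) (hY : Nonempty (ProjLim Y g)) :
    PartialEquiv (ProjLim X f) (ProjLim Y g) where
  toFun x := if h : ∀ i, x.1 i ∈ (e i).source then
      ⟨fun i => e i (x.1 i), fun i => by rw [← (he i _ (h (i + 1))).2, x.2]⟩ else hY.some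
  invFun y := if h : ∀ i, y.1 i ∈ (e i).target then
      ⟨fun i => (e i).symm (y.1 i), fun i => by
        have h1 := he i _ ((e (i + 1)).map_target (h (i + 1)))
        rw [(e (i + 1)).right_inv (h (i + 1)), y.2] at h1
        exact ((e i).left_inv h1.1).symm.trans (congrArg (e i).symm h1.2)⟩ else hX.some
  source := {x | ∀ i, x.1 i ∈ (e i).source}
  target := {y | ∀ i, y.1 i ∈ (e i).target}
  map_source' x hx := by
    have hx' : ∀ i, x.1 i ∈ (e i).source := hx
    simp only [dif_pos hx']
    exact fun i => (e i).map_source (hx i)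
  map_target' y hy := by
    have hy' : ∀ i, y.1 i ∈ (e i).target := hy
    simp only [dif_pos hy']
    exact fun i => (e i).map_target (hy i)
  left_inv' x hx := by
    have hx' : ∀ i, x.1 i ∈ (e i).source := hx
    have h2 : ∀ i, e i (x.1 i) ∈ (e i).target := fun i => (e i).map_source (hx i)
    simp only [dif_pos hx', dif_pos h2]
    exact Subtype.ext (funext fun i => (e i).left_inv (hx i))
  right_inv' y hy := by
    have hy' : ∀ i, y.1 i ∈ (e i).target := hy
    have h2 : ∀ i, (e i).symm (y.1 i) ∈ (e i).source := fun i => (e i).map_target (hy i)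
    simp only [dif_pos hy', dif_pos h2]
    exact Subtype.ext (funext fun i => (e i).right_inv (hy i))

end ProjLim

/-- Maps of class `C^n` on an open subset `U` of a real topological vector space, in the sense of
Michal-Bastiani (Hamilton): `f` is continuous on `U`, and, if `n > 0`, all directional derivatives
`df (x, v)` exist for `x ∈ U` and `df` is of class `C^{n-1}` on `U × F`. -/
def FrechetContDiffOn : ∀ (_ : ℕ) {F : Type w} {G : Type w'}
    [AddCommGroup F] [Module ℝ F] [TopologicalSpace F]
    [AddCommGroup G] [Module ℝ G] [TopologicalSpace G] (_ : F → G) (_ : Set F), Prop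
  | 0, _, _, _, _, _, _, _, _, f, U => ContinuousOn f U
  | n + 1, F, G, _, _, _, _, _, _, f, U => ContinuousOn f U ∧ ∃ df : F × F → G,
      (∀ x ∈ U, ∀ v : F,
        Tendsto (fun t : ℝ => t⁻¹ • (f (x + t • v) - f x)) (𝓝[≠] 0) (𝓝 (df (x, v)))) ∧
      FrechetContDiffOn n df (U ×ˢ univ)

namespace BanachManifold

/-! ### The infinite order iterated tangent bundle -/

/-- `T^∞M`, the projective limit of the `TⁱM` along the canonical projections. -/
abbrev TInf (M : BanachManifold.{u, v}) : Type (max u v) :=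
  ProjLim (fun i => (M.iter i).Carrier) (fun i => (M.iter i).proj)

/-- `T(T^∞M)`, the projective limit of the `T(TⁱM)` along the tangent maps of the projections. -/
abbrev TTInf (M : BanachManifold.{u, v}) : Type (max u v) :=
  ProjLim (fun i => (M.iter i).tangent.Carrier)
    (fun i => D (N := (M.iter i).tangent) (N' := M.iter i) (M.iter i).proj)

/-- `T²(T^∞M)`, the projective limit of the `T²(TⁱM)` along the second tangent maps. -/
abbrev TTTInf (M : BanachManifold.{u, v}) : Type (max u v) :=
  ProjLim (fun i => (M.iter i).tangent.tangent.Carrier)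
    (fun i => D (N := (M.iter i).tangent.tangent) (N' := (M.iter i).tangent)
      (D (N := (M.iter i).tangent) (N' := M.iter i) (M.iter i).proj))

/-- The connecting map `(x, y) ↦ x` of the model spaces. -/
noncomputable def vecProj (N : BanachManifold.{u, v}) : N.tangent.Vec →L[ℝ] N.Vec :=
  ContinuousLinearMap.fst ℝ N.Vec N.Vec

/-- The Fréchet space `𝔼_∞`, the projective limit of the model spaces of the `TⁱM`, a closed
subspace of their product. -/
noncomputable def VecInf (M : BanachManifold.{u, v}) : Submodule ℝ (∀ i, (M.iter i).Vec) where
  carrier := {x | ∀ i, (M.iter i).vecProj (x (i + 1)) = x i}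
  add_mem' {x y} hx hy i := by
    rw [Pi.add_apply, Pi.add_apply, ← hx i, ← hy i]; exact map_add (M.iter i).vecProj _ _
  zero_mem' i := map_zero (M.iter i).vecProj
  smul_mem' c x hx i := by
    rw [Pi.smul_apply, Pi.smul_apply, ← hx i]; exact map_smul (M.iter i).vecProj _ _

theorem proj_contMDiff (N : BanachManifold.{u, v}) :
    ContMDiff N.tangent.I N.I ∞ N.proj := by
  exact Bundle.contMDiff_proj _

theorem D_contMDiff {N N' : BanachManifold.{u, v}} {f : N.Carrier → N'.Carrier}
    (hf : ContMDiff N.I N'.I ∞ f) :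
    ContMDiff N.tangent.I N'.tangent.I ∞ (D (N := N) (N' := N') f) :=
  hf.contMDiff_tangentMap (m := ∞) (by norm_num)

theorem D_comp {N N' N'' : BanachManifold.{u, v}} {f : N.Carrier → N'.Carrier}
    {g : N'.Carrier → N''.Carrier} (hg : ContMDiff N'.I N''.I ∞ g) (hf : ContMDiff N.I N'.I ∞ f)
    (w : N.tangent.Carrier) :
    D (N := N) (N' := N'') (g ∘ f) w = D (N := N') (N' := N'') g (D (N := N) (N' := N') f w) :=
  tangentMap_comp_at w (hg.mdifferentiable (by norm_num) _) (hf.mdifferentiable (by norm_num) _)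

/-- The zero tangent vector at `x`. -/
noncomputable def zeroVec (N : BanachManifold.{u, v}) (x : N.Carrier) : N.tangent.Carrier :=
  (⟨x, 0⟩ : TangentBundle N.I N.Carrier)

theorem D_zeroVec {N N' : BanachManifold.{u, v}} (f : N.Carrier → N'.Carrier) (x : N.Carrier) :
    D (N := N) (N' := N') f (N.zeroVec x) = N'.zeroVec (f x) := by
  have h : mfderiv N.I N'.I f x 0 = 0 := ContinuousLinearMap.map_zero _
  exact congrArg (fun v => (⟨f x, v⟩ : TangentBundle N'.I N'.Carrier)) h

theorem mem_tangentChart_source (N : BanachManifold.{u, v}) (e : atlas N.Model N.Carrier)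
    (w : N.tangent.Carrier) :
    w ∈ (N.tangent.coord (N.tangentChart e)).source ↔ w.1 ∈ (N.coord e).source := by
  unfold coord
  rw [OpenPartialHomeomorph.extend_source, OpenPartialHomeomorph.extend_source]
  exact ⟨fun h => h.1, fun h => ⟨h, ⟨h, trivial⟩⟩⟩

theorem coord_mdifferentiableAt (N : BanachManifold.{u, v}) (e : atlas N.Model N.Carrier)
    {x : N.Carrier} (hx : x ∈ (N.coord e).source) :
    MDifferentiableAt N.I 𝓘(ℝ, N.Vec) (N.coord e) x := by
  have hx' : x ∈ e.1.source := by simpa [coord] using hx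
  have h := contMDiffOn_of_mem_maximalAtlas (IsManifold.subset_maximalAtlas (I := N.I) (n := ∞) e.2)
  have h1 := (h x hx').contMDiffAt (e.1.open_source.mem_nhds hx')
  exact (N.I.contMDiff.contMDiffAt.comp x h1).mdifferentiableAt (by norm_num)

theorem coord_tangentChart (N : BanachManifold.{u, v}) (e : atlas N.Model N.Carrier)
    (w : N.tangent.Carrier) (hw : w.1 ∈ (N.coord e).source) :
    N.tangent.coord (N.tangentChart e) w =
      (N.coord e w.1, mfderiv N.I 𝓘(ℝ, N.Vec) (N.coord e) w.1 w.2) := by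
  refine Prod.ext rfl ?_
  have h := N.coord_mdifferentiableAt e hw
  exact (congrArg (fun T => T w.2) h.mfderiv).symm

/-- Tangent maps respect induced charts. -/
theorem chart_compat {N N' : BanachManifold.{u, v}} {f : N'.Carrier → N.Carrier}
    (hf : ContMDiff N'.I N.I ∞ f) (e' : atlas N'.Model N'.Carrier) (e : atlas N.Model N.Carrier)
    (L : N'.Vec →L[ℝ] N.Vec)
    (h : ∀ x ∈ (N'.coord e').source, f x ∈ (N.coord e).source ∧
      N.coord e (f x) = L (N'.coord e' x)) :
    ∀ w ∈ (N'.tangent.coord (N'.tangentChart e')).source,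
      D (N := N') (N' := N) f w ∈ (N.tangent.coord (N.tangentChart e)).source ∧
      N.tangent.coord (N.tangentChart e) (D (N := N') (N' := N) f w) =
        (L.prodMap L) (N'.tangent.coord (N'.tangentChart e') w) := by
  intro w hw
  have hw' := (N'.mem_tangentChart_source e' w).1 hw
  have hfw := h _ hw'
  refine ⟨(N.mem_tangentChart_source e _).2 hfw.1, ?_⟩
  rw [N.coord_tangentChart e _ hfw.1, N'.coord_tangentChart e' w hw']
  refine Prod.ext hfw.2 ?_
  have hf' : MDifferentiableAt N'.I N.I f w.1 := hf.mdifferentiable (by norm_num) _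
  have h1 : mfderiv N'.I 𝓘(ℝ, N.Vec) (N.coord e ∘ f) w.1 =
      (mfderiv N.I 𝓘(ℝ, N.Vec) (N.coord e) (f w.1)).comp (mfderiv N'.I N.I f w.1) :=
    mfderiv_comp _ (N.coord_mdifferentiableAt e hfw.1) hf'
  have h2 : mfderiv N'.I 𝓘(ℝ, N.Vec) (L ∘ N'.coord e') w.1 =
      (mfderiv 𝓘(ℝ, N'.Vec) 𝓘(ℝ, N.Vec) L (N'.coord e' w.1)).comp
        (mfderiv N'.I 𝓘(ℝ, N'.Vec) (N'.coord e') w.1) :=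
    mfderiv_comp _ L.mdifferentiableAt (N'.coord_mdifferentiableAt e' hw')
  have hopen : (N'.coord e').source ∈ 𝓝 w.1 := e'.1.extend_source_mem_nhds (by
    simpa [coord] using hw')
  have h3 : (N.coord e ∘ f) =ᶠ[𝓝 w.1] (L ∘ N'.coord e') := by
    filter_upwards [hopen] with x hx using (h x hx).2
  have h4 := h3.mfderiv_eq (I := N'.I) (I' := 𝓘(ℝ, N.Vec))
  rw [h1, h2, L.mfderiv_eq] at h4
  exact congrArg (fun T => T w.2) h4

theorem chart_compat_zero (N : BanachManifold.{u, v}) (e : atlas N.Model N.Carrier) :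
    ∀ w ∈ (N.tangent.coord (N.tangentChart e)).source, N.proj w ∈ (N.coord e).source ∧
      N.coord e (N.proj w) = N.vecProj (N.tangent.coord (N.tangentChart e) w) :=
  fun w hw => ⟨(N.mem_tangentChart_source e w).1 hw, rfl⟩

/-- Auxiliary points of the iterated tangent bundles (iterated zero vectors). -/
noncomputable def zeroPt (M : BanachManifold.{u, v}) (x : M.Carrier) :
    ∀ i, (M.iter i).Carrier
  | 0 => x
  | i + 1 => (M.iter i).zeroVec (M.zeroPt x i)

theorem nonempty_TInf (M : BanachManifold.{u, v}) (x : M.Carrier) : Nonempty M.TInf :=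
  ⟨⟨M.zeroPt x, fun _ => rfl⟩⟩

theorem nonempty_TTInf (M : BanachManifold.{u, v}) (x : M.Carrier) : Nonempty M.TTInf :=
  ⟨⟨fun i => (M.iter i).zeroVec (M.zeroPt x i), fun i =>
    D_zeroVec (N := (M.iter i).tangent) (N' := M.iter i) (M.iter i).proj (M.zeroPt x (i + 1))⟩⟩

theorem nonempty_TTTInf (M : BanachManifold.{u, v}) (x : M.Carrier) : Nonempty M.TTTInf := by
  obtain ⟨ξ⟩ := M.nonempty_TTInf x
  exact ⟨⟨fun i => (M.iter i).tangent.zeroVec (ξ.1 i), fun i =>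
    (D_zeroVec (N := (M.iter i).tangent.tangent) (N' := (M.iter i).tangent)
      (D (N := (M.iter i).tangent) (N' := M.iter i) (M.iter i).proj) (ξ.1 (i + 1))).trans
      (congrArg (M.iter i).tangent.zeroVec (ξ.2 i))⟩⟩

/-- A point of `M`, obtained from a chart. -/
noncomputable def chartPt (M : BanachManifold.{u, v}) (α : atlas M.Model M.Carrier) : M.Carrier :=
  (M.coord α).symm 0

/-- Limits of model vectors are elements of `𝔼_∞`. -/
def equivVecInf (M : BanachManifold.{u, v}) :
    ProjLim (fun i => (M.iter i).Vec) (fun i => (M.iter i).vecProj) ≃ M.VecInf :=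
  Equiv.refl _

/-- `lim (𝔼ᵢ × 𝔼ᵢ) = 𝔼_∞ × 𝔼_∞`. -/
def equivVecInf₂ (M : BanachManifold.{u, v}) :
    ProjLim (fun i => (M.iter i).tangent.Vec)
      (fun i => (M.iter i).vecProj.prodMap (M.iter i).vecProj) ≃ M.VecInf × M.VecInf where
  toFun z :=
    (⟨fun i => (z.1 i).1, fun i => by have h := congrArg Prod.fst (z.2 i); exact h⟩,
     ⟨fun i => (z.1 i).2, fun i => by have h := congrArg Prod.snd (z.2 i); exact h⟩)
  invFun p := ⟨fun i => (p.1.1 i, p.2.1 i), fun i => Prod.ext (p.1.2 i) (p.2.2 i)⟩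

/-- `lim (𝔼ᵢ⁴) = 𝔼_∞⁴`. -/
def equivVecInf₄ (M : BanachManifold.{u, v}) :
    ProjLim (fun i => (M.iter i).tangent.tangent.Vec)
      (fun i => ((M.iter i).vecProj.prodMap (M.iter i).vecProj).prodMap
        ((M.iter i).vecProj.prodMap (M.iter i).vecProj)) ≃
      (M.VecInf × M.VecInf) × (M.VecInf × M.VecInf) where
  toFun z :=
    ((⟨fun i => (z.1 i).1.1, fun i => by have h := congrArg (fun p => p.1.1) (z.2 i); exact h⟩,
      ⟨fun i => (z.1 i).1.2, fun i => by have h := congrArg (fun p => p.1.2) (z.2 i); exact h⟩),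
     (⟨fun i => (z.1 i).2.1, fun i => by have h := congrArg (fun p => p.2.1) (z.2 i); exact h⟩,
      ⟨fun i => (z.1 i).2.2, fun i => by have h := congrArg (fun p => p.2.2) (z.2 i); exact h⟩))
  invFun p := ⟨fun i => ((p.1.1.1 i, p.1.2.1 i), (p.2.1.1 i, p.2.2.1 i)), fun i =>
    Prod.ext (Prod.ext (p.1.1.2 i) (p.1.2.2 i)) (Prod.ext (p.2.1.2 i) (p.2.2.2 i))⟩

/-- The limit chart `φ_{α_∞} = lim φ_{αᵢ}` of `T^∞M`, with values in `𝔼_∞`. -/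
noncomputable def limChart (M : BanachManifold.{u, v}) (α : atlas M.Model M.Carrier) :
    PartialEquiv M.TInf M.VecInf :=
  (ProjLim.chart (fun i => (M.iter i).coord (M.iterChart α i))
    (fun i => (M.iter i).chart_compat_zero (M.iterChart α i))
    (M.nonempty_TInf (M.chartPt α)) ⟨M.equivVecInf.symm 0⟩).transEquiv M.equivVecInf

/-- The limit chart `lim Dφ_{αᵢ}` of `T(T^∞M)`, with values in `𝔼_∞ × 𝔼_∞`. -/
noncomputable def limTangentChart (M : BanachManifold.{u, v}) (α : atlas M.Model M.Carrier) :
    PartialEquiv M.TTInf (M.VecInf × M.VecInf) :=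
  (ProjLim.chart
    (fun i => (M.iter i).tangent.coord ((M.iter i).tangentChart (M.iterChart α i)))
    (fun i => chart_compat (M.iter i).proj_contMDiff _ _ (M.iter i).vecProj
      ((M.iter i).chart_compat_zero (M.iterChart α i)))
    (M.nonempty_TTInf (M.chartPt α)) ⟨M.equivVecInf₂.symm 0⟩).transEquiv M.equivVecInf₂

/-- The limit chart `lim D²φ_{αᵢ}` of `T²(T^∞M)`, with values in `𝔼_∞⁴`. -/
noncomputable def limTangentTangentChart (M : BanachManifold.{u, v})
    (α : atlas M.Model M.Carrier) :
    PartialEquiv M.TTTInf ((M.VecInf × M.VecInf) × (M.VecInf × M.VecInf)) :=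
  (ProjLim.chart
    (fun i => (M.iter i).tangent.tangent.coord
      ((M.iter i).tangent.tangentChart ((M.iter i).tangentChart (M.iterChart α i))))
    (fun i => chart_compat (D_contMDiff (M.iter i).proj_contMDiff) _ _ _
      (chart_compat (M.iter i).proj_contMDiff _ _ (M.iter i).vecProj
        ((M.iter i).chart_compat_zero (M.iterChart α i))))
    (M.nonempty_TTTInf (M.chartPt α)) ⟨M.equivVecInf₄.symm 0⟩).transEquiv M.equivVecInf₄

/-- The tangent bundle projection `π_{T(T^∞M)} : T²(T^∞M) → T(T^∞M)`. -/
noncomputable def projTTInf (M : BanachManifold.{u, v}) : M.TTTInf → M.TTInf :=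
  ProjLim.map (fun i => (M.iter i).tangent.proj) (fun _ _ => rfl)

/-- The tangent map `Dπ : T²(T^∞M) → T(T^∞M)` of the projection `π : T(T^∞M) → T^∞M`. -/
noncomputable def DprojTInf (M : BanachManifold.{u, v}) : M.TTTInf → M.TTInf :=
  ProjLim.map (fun i => D (N := (M.iter i).tangent) (N' := M.iter i) (M.iter i).proj)
    (fun i w => (D_comp (N := (M.iter i).tangent.tangent) (N' := (M.iter i).tangent)
        (N'' := M.iter i) (M.iter i).proj_contMDiff (M.iter i).tangent.proj_contMDiff w).symm.trans
      (D_comp (N := (M.iter i).tangent.tangent) (N' := (M.iter i).tangent) (N'' := M.iter i)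
        (M.iter i).proj_contMDiff (D_contMDiff (M.iter i).proj_contMDiff) w))

/-- The local representation of `S : T(T^∞M) → T²(T^∞M)` in the charts induced by `α`. -/
noncomputable def limLocalRep (M : BanachManifold.{u, v}) (α : atlas M.Model M.Carrier)
    (S : M.TTInf → M.TTTInf) :
    M.VecInf × M.VecInf → (M.VecInf × M.VecInf) × (M.VecInf × M.VecInf) :=
  M.limTangentTangentChart α ∘ S ∘ (M.limTangentChart α).symm

/-- A semispray on `T^∞M`: a smooth vector field `S` on `T(T^∞M)` with `Dπ ∘ S = id`. -/
structure IsSemisprayInf (M : BanachManifold.{u, v}) (S : M.TTInf → M.TTTInf) : Prop where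
  continuous : Continuous S
  smooth : ∀ (α : atlas M.Model M.Carrier) (n : ℕ),
    FrechetContDiffOn n (M.limLocalRep α S) (M.limTangentChart α).target
  proj_eq : ∀ ξ, M.projTTInf (S ξ) = ξ
  Dproj_eq : ∀ ξ, M.DprojTInf (S ξ) = ξ

/-- The local component `G_α` of a semispray `S` on `T^∞M`, that is
`S_α (x, y) = (x, y; y, -2 G_α (x, y))` for the local representation `S_α` of `S`. -/
noncomputable def limLocalComponent (M : BanachManifold.{u, v}) (α : atlas M.Model M.Carrier)
    (S : M.TTInf → M.TTTInf) : M.VecInf × M.VecInf → M.VecInf :=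
  fun p => (-1 / 2 : ℝ) • (M.limLocalRep α S p).2.2

/-- A (2-homogeneous) spray on `T^∞M`. -/
structure IsSprayInf (M : BanachManifold.{u, v}) (S : M.TTInf → M.TTTInf) : Prop where
  semispray : M.IsSemisprayInf S
  homogeneous : ∀ (α : atlas M.Model M.Carrier), ∀ x ∈ (M.limChart α).target,
    ∀ (y : M.VecInf) (c : ℝ),
      M.limLocalComponent α S (x, c • y) = c ^ 2 • M.limLocalComponent α S (x, y)

end BanachManifold

/-! Everything is read off in induced charts, where the theorem becomes a computation with
derivatives. Second tangent maps of transition maps commute with the swap of the two middle entries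
because second derivatives are symmetric, so the canonical involution is the same swap in every
induced chart (`coord_involution`).

If a semispray is locally `(x, y; y, H(x, y))` with `H = -2G`, tracking coordinates through the four
factors of the complete lift shows that `S^c` sends `(x, y, X, Y)` to `(x, y, X, Y; X, Y, H(x, X),
dH(x, X)(y, Y))` (`coord_completeLift`). This formula carries the finite-level part. The repeated
pair `(X, Y)` makes `S^c` a semispray. Differentiating `H(x, cξ) = c²H(x, ξ)` gives `dH(x, cX)(y,
cY) = c² dH(x, X)(y, Y)`, so `S^c` is homogeneous. Deleting `y`, `Y` and the derivative term returns
`S`, which is compatibility with the projections (`DD_proj_completeLift`).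

In the limit, algebraic identities hold because they hold at each level. Smoothness is the general
fact `FrechetContDiffOn.of_projections`: the limit space carries the initial topology and contains
the limit of every difference quotient that converges at each level, so directional derivatives
exist and again form a projective system of smooth maps. Each limit chart has open image because
membership is decided at level zero. -/

namespace BanachManifold

/-! ### Local representations in induced charts -/

theorem coord_source (N : BanachManifold.{u, v}) (e : atlas N.Model N.Carrier) :
    (N.coord e).source = e.1.source := e.1.extend_source

theorem exists_chart (N : BanachManifold.{u, v}) (x : N.Carrier) :
    ∃ e : atlas N.Model N.Carrier, x ∈ (N.coord e).source :=
  ⟨achart N.Model x, by rw [coord_source]; exact mem_chart_source N.Model x⟩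

theorem isOpen_coord_target (N : BanachManifold.{u, v}) (e : atlas N.Model N.Carrier) :
    IsOpen (N.coord e).target := e.1.isOpen_extend_target

theorem coord_source_mem_nhds (N : BanachManifold.{u, v}) (e : atlas N.Model N.Carrier)
    {x : N.Carrier} (hx : x ∈ (N.coord e).source) : (N.coord e).source ∈ 𝓝 x :=
  e.1.extend_source_mem_nhds (by rwa [coord_source] at hx)

theorem contMDiffAt_coord (N : BanachManifold.{u, v}) (e : atlas N.Model N.Carrier)
    {x : N.Carrier} (hx : x ∈ (N.coord e).source) :
    ContMDiffAt N.I 𝓘(ℝ, N.Vec) ∞ (N.coord e) x := by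
  rw [coord_source] at hx
  exact (OpenPartialHomeomorph.contMDiffOn_extend
    (IsManifold.subset_maximalAtlas (I := N.I) (n := ∞) e.2)).contMDiffAt
      (e.1.open_source.mem_nhds hx)

theorem contMDiffAt_coord_symm (N : BanachManifold.{u, v}) (e : atlas N.Model N.Carrier)
    {p : N.Vec} (hp : p ∈ (N.coord e).target) :
    ContMDiffAt 𝓘(ℝ, N.Vec) N.I ∞ (N.coord e).symm p := by
  have h := contMDiffOn_extend_symm (IsManifold.subset_maximalAtlas (I := N.I) (n := ∞) e.2)
  have h2 : N.I '' e.1.target = (N.coord e).target := by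
    rw [coord, e.1.extend_target_eq_image_source, ← e.1.image_source_eq_target]
    simp [image_image]
  rw [h2] at h
  exact h.contMDiffAt ((N.isOpen_coord_target e).mem_nhds hp)

theorem tangentChart_target (N : BanachManifold.{u, v}) (e : atlas N.Model N.Carrier) :
    (N.tangent.coord (N.tangentChart e)).target = (N.coord e).target ×ˢ univ := by
  ext p
  constructor
  · intro hp
    have h := (N.tangent.coord (N.tangentChart e)).map_target hp
    rw [mem_tangentChart_source] at h
    have h2 := (N.coord e).map_source h
    have h3 := (N.tangent.coord (N.tangentChart e)).right_inv hp
    exact ⟨(congrArg Prod.fst h3) ▸ h2, trivial⟩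
  · rintro ⟨hp, -⟩
    unfold coord at hp ⊢
    rw [OpenPartialHomeomorph.extend_target] at hp ⊢
    refine ⟨⟨⟨hp.1, trivial⟩, ⟨e.1.map_target hp.1, trivial⟩⟩, ?_⟩
    rw [N.tangent.I.range_eq_univ]
    trivial

/-- The local representation of a smooth map is smooth. -/
theorem contDiffAt_localRep {N N' : BanachManifold.{u, v}} {f : N.Carrier → N'.Carrier}
    (e : atlas N.Model N.Carrier) (e' : atlas N'.Model N'.Carrier) {p : N.Vec}
    (hp : p ∈ (N.coord e).target) (hf : ContMDiffAt N.I N'.I ∞ f ((N.coord e).symm p))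
    (hfp : f ((N.coord e).symm p) ∈ (N'.coord e').source) :
    ContDiffAt ℝ ∞ (fun q => N'.coord e' (f ((N.coord e).symm q))) p := by
  rw [← contMDiffAt_iff_contDiffAt]
  exact (N'.contMDiffAt_coord e' hfp).comp p (hf.comp p (N.contMDiffAt_coord_symm e hp))

/-- The local representation of a tangent map. -/
theorem coord_D {N N' : BanachManifold.{u, v}} {f : N.Carrier → N'.Carrier}
    (e : atlas N.Model N.Carrier) (e' : atlas N'.Model N'.Carrier) {F : N.Vec → N'.Vec}
    {w : N.tangent.Carrier} (hf : MDifferentiableAt N.I N'.I f w.1)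
    (hw : w.1 ∈ (N.coord e).source) (hfw : f w.1 ∈ (N'.coord e').source)
    (hF : DifferentiableAt ℝ F (N.coord e w.1))
    (h : (fun x => N'.coord e' (f x)) =ᶠ[𝓝 w.1] fun x => F (N.coord e x)) :
    N'.tangent.coord (N'.tangentChart e') (D (N := N) (N' := N') f w) =
      (F (N.coord e w.1), fderiv ℝ F (N.coord e w.1) (N.tangent.coord (N.tangentChart e) w).2) := by
  rw [N'.coord_tangentChart e' _ hfw, N.coord_tangentChart e w hw]
  refine Prod.ext h.self_of_nhds ?_
  have h1 : mfderiv N.I 𝓘(ℝ, N'.Vec) (N'.coord e' ∘ f) w.1 =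
      (mfderiv N'.I 𝓘(ℝ, N'.Vec) (N'.coord e') (f w.1)).comp (mfderiv N.I N'.I f w.1) :=
    mfderiv_comp _ (N'.coord_mdifferentiableAt e' hfw) hf
  have h2 : mfderiv N.I 𝓘(ℝ, N'.Vec) (F ∘ N.coord e) w.1 =
      (mfderiv 𝓘(ℝ, N.Vec) 𝓘(ℝ, N'.Vec) F (N.coord e w.1)).comp
        (mfderiv N.I 𝓘(ℝ, N.Vec) (N.coord e) w.1) :=
    mfderiv_comp _ hF.mdifferentiableAt (N.coord_mdifferentiableAt e hw)
  have h4 := EventuallyEq.mfderiv_eq (I := N.I) (I' := 𝓘(ℝ, N'.Vec)) h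
  rw [mfderiv_eq_fderiv] at h2
  exact congrArg (fun T => T w.2) (h1.symm.trans (h4.trans h2))

/-- The transition map between charts. -/
noncomputable def transition (N : BanachManifold.{u, v}) (e e' : atlas N.Model N.Carrier) :
    N.Vec → N.Vec := fun q => N.coord e' ((N.coord e).symm q)

theorem transition_coord (N : BanachManifold.{u, v}) (e e' : atlas N.Model N.Carrier)
    {x : N.Carrier} (hx : x ∈ (N.coord e).source) :
    N.transition e e' (N.coord e x) = N.coord e' x :=
  congrArg (N.coord e') ((N.coord e).left_inv hx)

theorem contDiffAt_transition (N : BanachManifold.{u, v}) (e e' : atlas N.Model N.Carrier)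
    {x : N.Carrier} (hx : x ∈ (N.coord e).source) (hx' : x ∈ (N.coord e').source) :
    ContDiffAt ℝ ∞ (N.transition e e') (N.coord e x) := by
  have h := (N.coord e).left_inv hx
  exact contDiffAt_localRep (f := id) e e' ((N.coord e).map_source hx) contMDiffAt_id
    (by rw [h]; exact hx')

theorem D_id (N : BanachManifold.{u, v}) : D (N := N) (N' := N) id = id := tangentMap_id

/-- A change of charts is the local representation of the identity, so this is `coord_D` for `id`.
-/
theorem coord_tangentChart_change (N : BanachManifold.{u, v}) (e e' : atlas N.Model N.Carrier)
    {F : N.Vec → N.Vec} {w : N.tangent.Carrier}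
    (hw : w.1 ∈ (N.coord e).source) (hw' : w.1 ∈ (N.coord e').source)
    (hF : DifferentiableAt ℝ F (N.coord e w.1))
    (h : ∀ x ∈ (N.coord e).source ∩ (N.coord e').source, N.coord e' x = F (N.coord e x)) :
    N.tangent.coord (N.tangentChart e') w =
      (F (N.coord e w.1), fderiv ℝ F (N.coord e w.1) (N.tangent.coord (N.tangentChart e) w).2) := by
  have := coord_D (f := id) (N := N) (N' := N) e e' (w := w) mdifferentiableAt_id hw hw' hF
    (by
      filter_upwards [N.coord_source_mem_nhds e hw, N.coord_source_mem_nhds e' hw'] with x h1 h2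
      exact h x ⟨h1, h2⟩)
  rwa [D_id] at this

/-- The tangent map of a map between open subsets of Banach spaces. -/
noncomputable def tangentFun {E F : Type*} [NormedAddCommGroup E] [NormedSpace ℝ E]
    [NormedAddCommGroup F] [NormedSpace ℝ F] (f : E → F) : E × E → F × F :=
  fun p => (f p.1, fderiv ℝ f p.1 p.2)

theorem contDiffAt_tangentFun {E F : Type*} [NormedAddCommGroup E] [NormedSpace ℝ E]
    [NormedAddCommGroup F] [NormedSpace ℝ F] {f : E → F} {p : E × E} (h : ContDiffAt ℝ ∞ f p.1) :
    ContDiffAt ℝ ∞ (tangentFun f) p :=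
  (h.comp p contDiffAt_fst).prodMk
    (((h.fderiv_right (m := ∞) (by norm_num)).comp p contDiffAt_fst).clm_apply contDiffAt_snd)

/-- With `q = (x, y, X, Y)`, the last entry of the second tangent map is `f'(x)Y + f''(x)(X, y)`.
Exchanging `y` and `X` leaves it unchanged by symmetry of the second derivative, while the two
middle entries `f'(x)y` and `f'(x)X` trade places. -/
theorem swapMiddle_tangentFun {E F : Type v} [NormedAddCommGroup E] [NormedSpace ℝ E]
    [NormedAddCommGroup F] [NormedSpace ℝ F] {f : E → F} {q : (E × E) × (E × E)}
    (h : ContDiffAt ℝ ∞ f q.1.1) :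
    tangentFun (tangentFun f) (swapMiddle E q) = swapMiddle F (tangentFun (tangentFun f) q) := by
  have h1 : ∀ (x y X Y : E), ContDiffAt ℝ ∞ f x → fderiv ℝ (tangentFun f) (x, y) (X, Y) =
      (fderiv ℝ f x X, fderiv ℝ f x Y + fderiv ℝ (fderiv ℝ f) x X y) := by
    intro x y X Y hx
    have ha : HasFDerivAt f (fderiv ℝ f x) (x, y).1 :=
      (hx.differentiableAt (by norm_num)).hasFDerivAt
    have hb : HasFDerivAt (fderiv ℝ f) (fderiv ℝ (fderiv ℝ f) x) (x, y).1 :=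
      ((hx.fderiv_right (m := ∞) (by norm_num)).differentiableAt (by norm_num)).hasFDerivAt
    have hc : HasFDerivAt (tangentFun f) _ (x, y) :=
      (ha.comp (x, y) hasFDerivAt_fst).prodMk
        ((hb.comp (x, y) hasFDerivAt_fst).clm_apply hasFDerivAt_snd)
    rw [hc.fderiv]
    rfl
  obtain ⟨⟨x, y⟩, X, Y⟩ := q
  have hs : fderiv ℝ (fderiv ℝ f) x y X = fderiv ℝ (fderiv ℝ f) x X y :=
    (h.isSymmSndFDerivAt (by simpa using ENat.LEInfty.out)).eq y X
  change (tangentFun f (x, X), fderiv ℝ (tangentFun f) (x, X) (y, Y)) =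
    swapMiddle F (tangentFun f (x, y), fderiv ℝ (tangentFun f) (x, y) (X, Y))
  rw [h1 x X y Y h, h1 x y X Y h, hs]
  rfl

/-! ### The canonical involution in charts -/

theorem mem_tangentTangentChart_source (N : BanachManifold.{u, v}) (e : atlas N.Model N.Carrier)
    (w : N.tangent.tangent.Carrier) :
    w ∈ (N.tangent.tangent.coord (N.tangent.tangentChart (N.tangentChart e))).source ↔
      w.1.1 ∈ (N.coord e).source := by
  rw [mem_tangentChart_source, mem_tangentChart_source]

theorem mem_tangentTangentChart_target (N : BanachManifold.{u, v}) (e : atlas N.Model N.Carrier)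
    (q : (N.Vec × N.Vec) × (N.Vec × N.Vec)) :
    q ∈ (N.tangent.tangent.coord (N.tangent.tangentChart (N.tangentChart e))).target ↔
      q.1.1 ∈ (N.coord e).target := by
  rw [tangentChart_target, tangentChart_target]
  exact ⟨fun h => h.1.1, fun h => ⟨⟨h, trivial⟩, trivial⟩⟩

theorem coord_change₁ (N : BanachManifold.{u, v}) (e e' : atlas N.Model N.Carrier)
    {w : N.tangent.Carrier}
    (hw : w.1 ∈ (N.coord e).source) (hw' : w.1 ∈ (N.coord e').source) :
    N.tangent.coord (N.tangentChart e') w =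
      tangentFun (N.transition e e') (N.tangent.coord (N.tangentChart e) w) :=
  N.coord_tangentChart_change e e' hw hw'
    ((N.contDiffAt_transition e e' hw hw').differentiableAt (by norm_num))
    (fun _ hx => (N.transition_coord e e' hx.1).symm)

theorem coord_change₂ (N : BanachManifold.{u, v}) (e e' : atlas N.Model N.Carrier)
    {w : N.tangent.tangent.Carrier}
    (hw : w.1.1 ∈ (N.coord e).source) (hw' : w.1.1 ∈ (N.coord e').source) :
    N.tangent.tangent.coord (N.tangent.tangentChart (N.tangentChart e')) w =
      tangentFun (tangentFun (N.transition e e'))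
        (N.tangent.tangent.coord (N.tangent.tangentChart (N.tangentChart e)) w) := by
  refine N.tangent.coord_tangentChart_change (N.tangentChart e) (N.tangentChart e')
    ((N.mem_tangentChart_source e _).2 hw) ((N.mem_tangentChart_source e' _).2 hw') ?_ ?_
  · exact (contDiffAt_tangentFun (p := N.tangent.coord (N.tangentChart e) w.1)
      (N.contDiffAt_transition e e' hw hw')).differentiableAt (by norm_num)
  · intro x hx
    exact N.coord_change₁ e e' ((N.mem_tangentChart_source e _).1 hx.1)
      ((N.mem_tangentChart_source e' _).1 hx.2)

/-- The preferred chart of the double tangent bundle at `w` is by definition the twofold induced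
chart of the preferred chart at the base point of `w`. -/
theorem involution_spec (N : BanachManifold.{u, v}) (w : N.tangent.tangent.Carrier) :
    ∃ e : atlas N.Model N.Carrier, w.1.1 ∈ (N.coord e).source ∧
      N.involution w = (N.tangent.tangent.coord (N.tangent.tangentChart (N.tangentChart e))).symm
        (swapMiddle N.Vec
          (N.tangent.tangent.coord (N.tangent.tangentChart (N.tangentChart e)) w)) := by
  refine ⟨achart N.Model w.1.1, ?_, rfl⟩
  rw [coord_source]
  exact mem_chart_source N.Model w.1.1

theorem involution_base (N : BanachManifold.{u, v}) (w : N.tangent.tangent.Carrier) :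
    (N.involution w).1.1 = w.1.1 := by
  obtain ⟨e, he, h⟩ := N.involution_spec w
  set φ := N.tangent.tangent.coord (N.tangent.tangentChart (N.tangentChart e)) with hφ
  have hw : w ∈ φ.source := (N.mem_tangentTangentChart_source e w).2 he
  have ht : swapMiddle N.Vec (φ w) ∈ φ.target :=
    (N.mem_tangentTangentChart_target e _).2 ((N.coord e).map_source he)
  have hs : N.involution w ∈ φ.source := h ▸ φ.map_target ht
  have hq : φ (N.involution w) = swapMiddle N.Vec (φ w) := by rw [h, φ.right_inv ht]
  exact (N.coord e).injOn ((N.mem_tangentTangentChart_source e _).1 hs) he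
    (congrArg (fun q : (N.Vec × N.Vec) × (N.Vec × N.Vec) => q.1.1) hq)

/-- In every induced chart the canonical involution is `(x, y, X, Y) ↦ (x, X, y, Y)`. -/
theorem coord_involution (N : BanachManifold.{u, v}) (e : atlas N.Model N.Carrier)
    {w : N.tangent.tangent.Carrier} (hw : w.1.1 ∈ (N.coord e).source) :
    N.tangent.tangent.coord (N.tangent.tangentChart (N.tangentChart e)) (N.involution w) =
      swapMiddle N.Vec
        (N.tangent.tangent.coord (N.tangent.tangentChart (N.tangentChart e)) w) := by
  obtain ⟨e', he, h⟩ := N.involution_spec w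
  have hb := N.involution_base w
  -- The chart `e'` defining the involution at `w` need not be `e`. Both sides are transported from
  -- `e'` by the second tangent map of the transition, which commutes with the swap.
  rw [N.coord_change₂ e' e (by rwa [hb]) (by rwa [hb]), N.coord_change₂ e' e he hw, h,
    PartialEquiv.right_inv _ ((N.mem_tangentTangentChart_target e' _).2
      ((N.coord e').map_source he))]
  exact swapMiddle_tangentFun (N.contDiffAt_transition e' e he hw)

/-- `swapMiddle` as a continuous linear map. -/
noncomputable def swapMiddleL (E : Type v) [NormedAddCommGroup E] [NormedSpace ℝ E] :
    (E × E) × (E × E) →L[ℝ] (E × E) × (E × E) :=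
  (((ContinuousLinearMap.fst ℝ E E).comp (ContinuousLinearMap.fst ℝ _ _)).prod
    ((ContinuousLinearMap.fst ℝ E E).comp (ContinuousLinearMap.snd ℝ _ _))).prod
  (((ContinuousLinearMap.snd ℝ E E).comp (ContinuousLinearMap.fst ℝ _ _)).prod
    ((ContinuousLinearMap.snd ℝ E E).comp (ContinuousLinearMap.snd ℝ _ _)))

/-- The definition uses a chart that varies with the point. Chart independence lets one fixed chart
serve on a whole neighbourhood, where the involution is a continuous linear map. -/
theorem involution_contMDiff (N : BanachManifold.{u, v}) :
    ContMDiff N.tangent.tangent.I N.tangent.tangent.I ∞ N.involution := by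
  intro w
  obtain ⟨e, he, h⟩ := N.involution_spec w
  set φ := N.tangent.tangent.coord (N.tangent.tangentChart (N.tangentChart e)) with hφ
  have hw : w ∈ φ.source := (N.mem_tangentTangentChart_source e w).2 he
  have ht : swapMiddle N.Vec (φ w) ∈ φ.target :=
    (N.mem_tangentTangentChart_target e _).2 ((N.coord e).map_source he)
  have hev : N.involution =ᶠ[𝓝 w] φ.symm ∘ (swapMiddleL N.Vec ∘ φ) := by
    filter_upwards [N.tangent.tangent.coord_source_mem_nhds _ hw] with z hz
    have hz1 := (N.mem_tangentTangentChart_source e z).1 hz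
    have hz2 := N.coord_involution e hz1
    have hz3 : N.involution z ∈ φ.source :=
      (N.mem_tangentTangentChart_source e _).2 (by rwa [involution_base])
    rw [← φ.left_inv hz3, hz2]
    rfl
  refine ContMDiffAt.congr_of_eventuallyEq ?_ hev
  refine (N.tangent.tangent.contMDiffAt_coord_symm _ ht).comp w ?_
  exact (swapMiddleL N.Vec).contDiff.contMDiff.contMDiffAt.comp w
    (N.tangent.tangent.contMDiffAt_coord _ hw)

end BanachManifold

namespace BanachManifold

/-! ### Semisprays and complete lifts in charts -/

/-- The map `(x, y) ↦ (x, y; y, H (x, y))`. -/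
def sprayFun {E : Type*} (H : E × E → E) : E × E → (E × E) × (E × E) := fun p => (p, (p.2, H p))

theorem hasFDerivAt_sprayFun {E : Type*} [NormedAddCommGroup E] [NormedSpace ℝ E]
    {H : E × E → E} {p : E × E} (h : DifferentiableAt ℝ H p) :
    HasFDerivAt (sprayFun H) ((ContinuousLinearMap.id ℝ (E × E)).prod
      ((ContinuousLinearMap.snd ℝ E E).prod (fderiv ℝ H p))) p :=
  (hasFDerivAt_id p).prodMk (hasFDerivAt_snd.prodMk h.hasFDerivAt)

/-- The last component of the local representation of a vector field on `TN`. -/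
noncomputable def vertical (N : BanachManifold.{u, v}) (e : atlas N.Model N.Carrier)
    (S : N.tangent.Carrier → N.tangent.tangent.Carrier) : N.Vec × N.Vec → N.Vec := fun p =>
  (N.tangent.tangent.coord (N.tangent.tangentChart (N.tangentChart e))
    (S ((N.tangent.coord (N.tangentChart e)).symm p))).2.2

theorem localComponent_eq (N : BanachManifold.{u, v}) (e : atlas N.Model N.Carrier)
    (S : N.tangent.Carrier → N.tangent.tangent.Carrier) (p : N.Vec × N.Vec) :
    N.localComponent e S p = (-1 / 2 : ℝ) • N.vertical e S p := rfl

namespace IsSemispray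

variable {N : BanachManifold.{u, v}} {S : N.tangent.Carrier → N.tangent.tangent.Carrier}

theorem base_eq (hS : N.IsSemispray S) (ξ : N.tangent.Carrier) : (S ξ).1 = ξ := hS.proj_eq ξ

theorem mem_source (hS : N.IsSemispray S) (e : atlas N.Model N.Carrier) {ξ : N.tangent.Carrier}
    (hξ : ξ.1 ∈ (N.coord e).source) :
    S ξ ∈ (N.tangent.tangent.coord (N.tangent.tangentChart (N.tangentChart e))).source := by
  rw [mem_tangentTangentChart_source, hS.base_eq]
  exact hξ

/-- In a chart a semispray has the form `(x, y) ↦ (x, y; y, H (x, y))`. -/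
theorem coord_eq (hS : N.IsSemispray S) (e : atlas N.Model N.Carrier) {ξ : N.tangent.Carrier}
    (hξ : ξ.1 ∈ (N.coord e).source) :
    N.tangent.tangent.coord (N.tangent.tangentChart (N.tangentChart e)) (S ξ) =
      sprayFun (N.vertical e S) (N.tangent.coord (N.tangentChart e) ξ) := by
  have h1 : (N.tangent.tangent.coord (N.tangent.tangentChart (N.tangentChart e)) (S ξ)).1 =
      N.tangent.coord (N.tangentChart e) ξ :=
    congrArg (N.tangent.coord (N.tangentChart e)) (hS.base_eq ξ)
  have hb : (S ξ).1.1 ∈ (N.coord e).source := (N.mem_tangentTangentChart_source e _).1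
    (hS.mem_source e hξ)
  have h2 := N.coord_involution e hb
  rw [hS.involution_eq] at h2
  -- Invariance under the swap forces the second and third entries to agree.
  have h3 : (N.tangent.tangent.coord (N.tangent.tangentChart (N.tangentChart e)) (S ξ)).2.1 =
      (N.tangent.tangent.coord (N.tangent.tangentChart (N.tangentChart e)) (S ξ)).1.2 :=
    congrArg (fun q : (N.Vec × N.Vec) × (N.Vec × N.Vec) => q.2.1) h2
  refine Prod.ext h1 (Prod.ext (h3.trans (congrArg Prod.snd h1)) ?_)
  change _ = (N.tangent.tangent.coord _ (S ((N.tangent.coord (N.tangentChart e)).symm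
    (N.tangent.coord (N.tangentChart e) ξ)))).2.2
  rw [(N.tangent.coord (N.tangentChart e)).left_inv ((N.mem_tangentChart_source e ξ).2 hξ)]

theorem contDiffAt_vertical (hS : N.IsSemispray S) (e : atlas N.Model N.Carrier)
    {p : N.Vec × N.Vec} (hp : p.1 ∈ (N.coord e).target) :
    ContDiffAt ℝ ∞ (N.vertical e S) p := by
  have hp' : p ∈ (N.tangent.coord (N.tangentChart e)).target := by
    rw [tangentChart_target]; exact ⟨hp, trivial⟩
  have h := contDiffAt_localRep (f := S) (N.tangentChart e) (N.tangent.tangentChart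
    (N.tangentChart e)) hp' (hS.smooth _) (hS.mem_source e ((N.mem_tangentChart_source e _).1
      ((N.tangent.coord (N.tangentChart e)).map_target hp')))
  exact h.snd.snd

/-- The local representation of the complete lift. -/
theorem coord_completeLift (hS : N.IsSemispray S) (e : atlas N.Model N.Carrier)
    {w : N.tangent.tangent.Carrier} (hw : w.1.1 ∈ (N.coord e).source) {x y X Y : N.Vec}
    (hc : N.tangent.tangent.coord (N.tangent.tangentChart (N.tangentChart e)) w =
      ((x, y), (X, Y))) :
    (N.completeLift S w).1.1.1 ∈ (N.coord e).source ∧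
    N.tangent.tangent.tangent.coord (N.tangent.tangent.tangentChart (N.tangent.tangentChart
      (N.tangentChart e))) (N.completeLift S w) =
      (((x, y), (X, Y)), ((X, Y), (N.vertical e S (x, X),
        fderiv ℝ (N.vertical e S) (x, X) (y, Y)))) := by
  have hx : x ∈ (N.coord e).target := by
    have h := (N.coord e).map_source hw
    rwa [show N.coord e w.1.1 = x from congrArg (fun q => q.1.1) hc] at h
  -- Write `H` for the vertical component and `dH` for its derivative, evaluated at `(x, X)` and at
  -- `(x, X)`, `(y, Y)`. The points `w₁`, `w₂`, `w₃` and the lift have coordinates `(x, X; y, Y)`,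
  -- `(x, X, X, H; y, Y, Y, dH)`, `(x, X, y, Y; X, H, Y, dH)`, `(x, y, X, Y; X, Y, H, dH)`.
  set w₁ := N.involution w with hw₁
  have hb₁ : w₁.1.1 = w.1.1 := N.involution_base w
  have hs₁ : w₁.1.1 ∈ (N.coord e).source := hb₁ ▸ hw
  have hc₁ : N.tangent.tangent.coord (N.tangent.tangentChart (N.tangentChart e)) w₁ =
      ((x, X), (y, Y)) := by
    rw [hw₁, N.coord_involution e hw, hc]; rfl
  have hp₁ : N.tangent.coord (N.tangentChart e) w₁.1 = (x, X) := congrArg Prod.fst hc₁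
  set w₂ := D (N := N.tangent) (N' := N.tangent.tangent) S w₁ with hw₂
  have hb₂ : w₂.1.1 = w₁.1 := hS.base_eq w₁.1
  have hs₂ : w₂.1.1 ∈ (N.tangent.coord (N.tangentChart e)).source := by
    rw [hb₂]; exact (N.mem_tangentChart_source e _).2 hs₁
  have hF : HasFDerivAt (sprayFun (N.vertical e S)) _ (x, X) := hasFDerivAt_sprayFun
    ((hS.contDiffAt_vertical e (p := (x, X)) hx).differentiableAt (by norm_num))
  have hc₂ : N.tangent.tangent.tangent.coord (N.tangent.tangent.tangentChart
      (N.tangent.tangentChart (N.tangentChart e))) w₂ =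
      (((x, X), (X, N.vertical e S (x, X))), ((y, Y), (Y,
        fderiv ℝ (N.vertical e S) (x, X) (y, Y)))) := by
    rw [hw₂, coord_D (N := N.tangent) (N' := N.tangent.tangent) (f := S)
      (F := sprayFun (N.vertical e S)) (N.tangentChart e) _
      (hS.smooth.mdifferentiable (by norm_num) _) ((N.mem_tangentChart_source e _).2 hs₁)
      (hS.mem_source e hs₁) (by rw [hp₁]; exact hF.differentiableAt) ?_, hp₁, hF.fderiv, hc₁]
    · rfl
    · filter_upwards [N.tangent.coord_source_mem_nhds _
        ((N.mem_tangentChart_source e _).2 hs₁)] with ξ hξ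
      exact hS.coord_eq e ((N.mem_tangentChart_source e _).1 hξ)
  set w₃ := N.tangent.involution w₂ with hw₃
  have hb₃ : w₃.1.1 = w₂.1.1 := N.tangent.involution_base w₂
  have hs₃ : w₃.1.1.1 ∈ (N.coord e).source := by rw [hb₃, hb₂]; exact hs₁
  have hc₃ := N.tangent.coord_involution (N.tangentChart e) hs₂
  rw [hc₂, ← hw₃] at hc₃
  have hp₃ : N.tangent.tangent.coord (N.tangent.tangentChart (N.tangentChart e)) w₃.1 =
      ((x, X), (y, Y)) := congrArg Prod.fst hc₃
  have hb₄ : (N.completeLift S w).1.1.1 ∈ (N.coord e).source := by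
    change (N.involution w₃.1).1.1 ∈ _
    rw [involution_base]
    exact hs₃
  refine ⟨hb₄, ?_⟩
  change N.tangent.tangent.tangent.coord _
    (D (N := N.tangent.tangent) (N' := N.tangent.tangent) N.involution w₃) = _
  rw [coord_D (N := N.tangent.tangent) (N' := N.tangent.tangent) (f := N.involution)
    (F := swapMiddleL N.Vec) (N.tangent.tangentChart (N.tangentChart e)) _
    (N.involution_contMDiff.mdifferentiable (by norm_num) _)
    ((N.mem_tangentTangentChart_source e _).2 hs₃)
    ((N.mem_tangentTangentChart_source e _).2 hb₄)
    (swapMiddleL N.Vec).differentiableAt ?_, ContinuousLinearMap.fderiv, hp₃, hc₃]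
  · rfl
  · filter_upwards [N.tangent.tangent.coord_source_mem_nhds _
      ((N.mem_tangentTangentChart_source e _).2 hs₃)] with ξ hξ
    exact N.coord_involution e ((N.mem_tangentTangentChart_source e _).1 hξ)

/-- The complete lift of a semispray is a semispray. -/
theorem completeLift (hS : N.IsSemispray S) : N.tangent.IsSemispray (N.completeLift S) where
  smooth := (D_contMDiff N.involution_contMDiff).comp
    (N.tangent.involution_contMDiff.comp ((D_contMDiff hS.smooth).comp N.involution_contMDiff))
  proj_eq w := by
    obtain ⟨e, he⟩ := N.exists_chart w.1.1
    have h := hS.coord_completeLift e he (x := _) (y := _) (X := _) (Y := _) rfl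
    exact (N.tangent.tangent.coord (N.tangent.tangentChart (N.tangentChart e))).injOn
      ((N.mem_tangentTangentChart_source e _).2 h.1) ((N.mem_tangentTangentChart_source e _).2 he)
      (congrArg Prod.fst h.2)
  involution_eq w := by
    obtain ⟨e, he⟩ := N.exists_chart w.1.1
    have h := hS.coord_completeLift e he (x := _) (y := _) (X := _) (Y := _) rfl
    have hs := (N.mem_tangentChart_source e _).2 h.1
    refine (N.tangent.tangent.tangent.coord (N.tangent.tangent.tangentChart
      (N.tangent.tangentChart (N.tangentChart e)))).injOn
      ((N.tangent.mem_tangentTangentChart_source _ _).2 ?_)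
      ((N.tangent.mem_tangentTangentChart_source _ _).2 hs) ?_
    · rw [involution_base]; exact hs
    -- The swap exchanges two equal pairs `(X, Y)`.
    · rw [N.tangent.coord_involution _ hs, h.2]
      rfl

/-- The recursion that passes from the local component at one level to the next; homogeneity is
propagated through it. -/
theorem vertical_completeLift (hS : N.IsSemispray S) (e : atlas N.Model N.Carrier)
    {x y X Y : N.Vec} (hx : x ∈ (N.coord e).target) :
    N.tangent.vertical (N.tangentChart e) (N.completeLift S) ((x, y), (X, Y)) =
      (N.vertical e S (x, X), fderiv ℝ (N.vertical e S) (x, X) (y, Y)) := by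
  set φ := N.tangent.tangent.coord (N.tangent.tangentChart (N.tangentChart e)) with hφ
  have ht : ((x, y), (X, Y)) ∈ φ.target := (N.mem_tangentTangentChart_target e _).2 hx
  have h := hS.coord_completeLift e
    ((N.mem_tangentTangentChart_source e _).1 (φ.map_target ht)) (φ.right_inv ht)
  exact congrArg (fun q => q.2.2) h.2

/-- A semispray is a section of the tangent map of the projection. -/
theorem D_proj_eq (hS : N.IsSemispray S) (ξ : N.tangent.Carrier) :
    D (N := N.tangent) (N' := N) N.proj (S ξ) = ξ := by
  obtain ⟨e, he⟩ := N.exists_chart ξ.1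
  have h := chart_compat N.proj_contMDiff (N.tangentChart e) e N.vecProj
    (N.chart_compat_zero e) (S ξ) (hS.mem_source e he)
  refine (N.tangent.coord (N.tangentChart e)).injOn h.1 ((N.mem_tangentChart_source e ξ).2 he) ?_
  rw [h.2, hS.coord_eq e he]
  rfl

/-- The complete lift is related to the semispray by the tangent maps of the projection. -/
theorem DD_proj_completeLift (hS : N.IsSemispray S) (w : N.tangent.tangent.Carrier) :
    D (N := N.tangent.tangent) (N' := N.tangent) (D (N := N.tangent) (N' := N) N.proj)
      (N.completeLift S w) = S (D (N := N.tangent) (N' := N) N.proj w) := by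
  obtain ⟨e, he⟩ := N.exists_chart w.1.1
  have h := hS.coord_completeLift e he (x := _) (y := _) (X := _) (Y := _) rfl
  have h₁ := chart_compat N.proj_contMDiff (N.tangentChart e) e N.vecProj
    (N.chart_compat_zero e)
  have h₂ := chart_compat (D_contMDiff N.proj_contMDiff) _ _ _ h₁ (N.completeLift S w)
    ((N.tangent.mem_tangentTangentChart_source _ _).2 ((N.mem_tangentChart_source e _).2 h.1))
  have h₃ := h₁ w ((N.mem_tangentTangentChart_source e _).2 he)
  have h₄ := (N.mem_tangentChart_source e _).1 h₃.1
  refine PartialEquiv.injOn _ h₂.1 (hS.mem_source e h₄) ?_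
  -- Keeping the first entry of each of the four pairs leaves `(x, X; X, H(x, X))`, the value of the
  -- semispray at `(x, X)`.
  rw [h₂.2, hS.coord_eq e h₄, h₃.2, h.2]
  rfl

end IsSemispray

/-! ### Homogeneity of complete lifts. -/

/-- Differentiate both sides of `H(x, cξ) = c²H(x, ξ)` jointly in `(x, ξ)`, with `c` fixed, in the
direction `(y, Y)`. Openness of `U` makes the identity hold near the point, and no division by `c`
occurs, so `c = 0` is covered. -/
theorem fderiv_homogeneous {E F : Type*} [NormedAddCommGroup E] [NormedSpace ℝ E]
    [NormedAddCommGroup F] [NormedSpace ℝ F] {H : E × E → F} {U : Set E} (hU : IsOpen U)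
    (hH : ∀ p : E × E, p.1 ∈ U → DifferentiableAt ℝ H p)
    (hom : ∀ x ∈ U, ∀ (ξ : E) (c : ℝ), H (x, c • ξ) = c ^ 2 • H (x, ξ))
    {x : E} (hx : x ∈ U) (ξ y Y : E) (c : ℝ) :
    fderiv ℝ H (x, c • ξ) (y, c • Y) = c ^ 2 • fderiv ℝ H (x, ξ) (y, Y) := by
  have h1 : HasFDerivAt (fun p : E × E => (p.1, c • p.2))
      ((ContinuousLinearMap.fst ℝ E E).prod (c • ContinuousLinearMap.snd ℝ E E)) (x, ξ) :=
    hasFDerivAt_fst.prodMk (hasFDerivAt_snd.const_smul c)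
  have h2 : HasFDerivAt (fun p : E × E => H (p.1, c • p.2)) _ (x, ξ) :=
    HasFDerivAt.comp (x, ξ) (hH (x, c • ξ) hx).hasFDerivAt h1
  have h3 : HasFDerivAt (fun p : E × E => c ^ 2 • H p) _ (x, ξ) :=
    (hH (x, ξ) hx).hasFDerivAt.const_smul (c ^ 2)
  have hev : (fun p : E × E => c ^ 2 • H p) =ᶠ[𝓝 (x, ξ)] fun p => H (p.1, c • p.2) := by
    filter_upwards [(hU.preimage continuous_fst).mem_nhds (show (x, ξ).1 ∈ U from hx)] with p hp
    exact (hom p.1 hp p.2 c).symm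
  exact congrArg (fun T => T (y, Y)) (h2.unique (h3.congr_of_eventuallyEq hev.symm))

theorem vertical_homogeneous_iff (N : BanachManifold.{u, v}) (e : atlas N.Model N.Carrier)
    (S : N.tangent.Carrier → N.tangent.tangent.Carrier) (x ξ : N.Vec) (c : ℝ) :
    N.localComponent e S (x, c • ξ) = c ^ 2 • N.localComponent e S (x, ξ) ↔
      N.vertical e S (x, c • ξ) = c ^ 2 • N.vertical e S (x, ξ) := by
  rw [localComponent_eq, localComponent_eq, smul_comm]
  exact (smul_right_injective N.Vec (by norm_num : (-1 / 2 : ℝ) ≠ 0)).eq_iff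

/-- The complete lift of a spray is a spray. -/
theorem IsSpray.completeLift {M : BanachManifold.{u, v}} {i : ℕ}
    {S : (M.iter i).tangent.Carrier → (M.iter i).tangent.tangent.Carrier} (hS : M.IsSpray i S) :
    M.IsSpray (i + 1) ((M.iter i).completeLift S) where
  semispray := hS.semispray.completeLift
  homogeneous α := by
    change ∀ p ∈ ((M.iter i).tangent.coord ((M.iter i).tangentChart (M.iterChart α i))).target,
      ∀ (q : (M.iter i).Vec × (M.iter i).Vec) (c : ℝ),
        (M.iter i).tangent.localComponent ((M.iter i).tangentChart (M.iterChart α i))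
          ((M.iter i).completeLift S) (p, c • q) =
        c ^ 2 • (M.iter i).tangent.localComponent ((M.iter i).tangentChart (M.iterChart α i))
          ((M.iter i).completeLift S) (p, q)
    rintro ⟨x, y⟩ hp ⟨X, Y⟩ c
    rw [tangentChart_target] at hp
    have hx : x ∈ ((M.iter i).coord (M.iterChart α i)).target := hp.1
    have hom : ∀ x ∈ ((M.iter i).coord (M.iterChart α i)).target, ∀ (ξ : (M.iter i).Vec) (c : ℝ),
        (M.iter i).vertical (M.iterChart α i) S (x, c • ξ) =
          c ^ 2 • (M.iter i).vertical (M.iterChart α i) S (x, ξ) := fun x hx ξ c =>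
      (vertical_homogeneous_iff _ _ _ _ _ _).1 (hS.homogeneous α x hx ξ c)
    refine (vertical_homogeneous_iff (M.iter i).tangent _ _ _ _ _).2 ?_
    rw [Prod.smul_mk, hS.semispray.vertical_completeLift _ hx,
      hS.semispray.vertical_completeLift _ hx, hom x hx,
      fderiv_homogeneous ((M.iter i).isOpen_coord_target _)
        (fun p hp => (hS.semispray.contDiffAt_vertical _ hp).differentiableAt (by norm_num))
        hom hx, Prod.smul_mk]

theorem IsSpray.iterLift {M : BanachManifold.{u, v}}
    {S : M.tangent.Carrier → M.tangent.tangent.Carrier} (hS : M.IsSpray 0 S) :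
    ∀ i, M.IsSpray i (M.iterLift S i)
  | 0 => hS
  | i + 1 => (IsSpray.iterLift hS i).completeLift

end BanachManifold

/-! ### Smooth maps between projective limits -/

/-- A family of continuous linear maps which identifies `W` with a closed subspace of the product
of the targets. -/
structure IsClosedFamily {W : Type*} [AddCommGroup W] [Module ℝ W] [TopologicalSpace W]
    {Y : ℕ → Type*} [∀ i, NormedAddCommGroup (Y i)] [∀ i, NormedSpace ℝ (Y i)]
    (q : ∀ i, W →L[ℝ] Y i) : Prop where
  nhds_le : ∀ a : W, ⨅ i, comap (q i) (𝓝 (q i a)) ≤ 𝓝 a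
  -- Closedness in the form needed for derivatives: difference quotients converging at every level
  -- have their levelwise limits realised by a vector of `W`.
  exists_eq : ∀ (l : Filter W) [l.NeBot] (c : ∀ i, Y i),
    (∀ i, Tendsto (q i) l (𝓝 (c i))) → ∃ a, ∀ i, q i a = c i

namespace IsClosedFamily

variable {W : Type*} [AddCommGroup W] [Module ℝ W] [TopologicalSpace W]
  {Y : ℕ → Type*} [∀ i, NormedAddCommGroup (Y i)] [∀ i, NormedSpace ℝ (Y i)]
  {q : ∀ i, W →L[ℝ] Y i}

theorem tendsto (hq : IsClosedFamily q) {β : Type*} {l : Filter β} {φ : β → W} {a : W}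
    (h : ∀ i, Tendsto (fun b => q i (φ b)) l (𝓝 (q i a))) : Tendsto φ l (𝓝 a) :=
  Tendsto.mono_right (tendsto_iInf.2 fun i => tendsto_comap_iff.2 (h i)) (hq.nhds_le a)

theorem prodMap (hq : IsClosedFamily q) : IsClosedFamily fun i => (q i).prodMap (q i) where
  nhds_le a := by
    have h : ∀ i, Tendsto ((q i).prodMap (q i))
        (⨅ i, comap ((q i).prodMap (q i)) (𝓝 ((q i).prodMap (q i) a)))
        (𝓝 ((q i).prodMap (q i) a)) := fun i =>
      tendsto_comap.mono_left
        (iInf_le (fun i => comap ((q i).prodMap (q i)) (𝓝 ((q i).prodMap (q i) a))) i)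
    have h1 : Tendsto Prod.fst (⨅ i, comap ((q i).prodMap (q i)) (𝓝 ((q i).prodMap (q i) a)))
        (𝓝 a.1) := hq.tendsto fun i => by
      exact (continuous_fst.tendsto _).comp (h i)
    have h2 : Tendsto Prod.snd (⨅ i, comap ((q i).prodMap (q i)) (𝓝 ((q i).prodMap (q i) a)))
        (𝓝 a.2) := hq.tendsto fun i => by
      exact (continuous_snd.tendsto _).comp (h i)
    exact h1.prodMk_nhds h2
  exists_eq l _ c h := by
    obtain ⟨a, ha⟩ := hq.exists_eq (l.map Prod.fst) (fun i => (c i).1)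
      fun i => (continuous_fst.tendsto _).comp (h i)
    obtain ⟨b, hb⟩ := hq.exists_eq (l.map Prod.snd) (fun i => (c i).2)
      fun i => (continuous_snd.tendsto _).comp (h i)
    exact ⟨(a, b), fun i => Prod.ext (ha i) (hb i)⟩

end IsClosedFamily

/-- The limit of a projective system of smooth maps is smooth. -/
theorem FrechetContDiffOn.of_projections {W : Type w'} [AddCommGroup W] [Module ℝ W]
    [TopologicalSpace W] {Y : ℕ → Type*} [∀ i, NormedAddCommGroup (Y i)]
    [∀ i, NormedSpace ℝ (Y i)] {q : ∀ i, W →L[ℝ] Y i} (hq : IsClosedFamily q) (n : ℕ)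
    {V : Type w} [AddCommGroup V] [Module ℝ V] [TopologicalSpace V] [ContinuousAdd V]
    [ContinuousSMul ℝ V] {X : ℕ → Type v} [∀ i, NormedAddCommGroup (X i)]
    [∀ i, NormedSpace ℝ (X i)] (p : ∀ i, V →L[ℝ] X i) {U : Set V} (hU : IsOpen U)
    {F : V → W} {f : ∀ i, X i → Y i} {s : ∀ i, Set (X i)} (hs : ∀ i, ∀ x ∈ U, p i x ∈ s i)
    (hf : ∀ i, ∀ x ∈ s i, ContDiffAt ℝ ∞ (f i) x) (hF : ∀ i, ∀ x ∈ U, q i (F x) = f i (p i x)) :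
    FrechetContDiffOn n F U := by
  have hcont : ContinuousOn F U := fun x hx => hq.tendsto fun i => by
    rw [hF i x hx]
    refine Tendsto.congr' (f₁ := fun x => f i (p i x)) ?_ ?_
    · filter_upwards [self_mem_nhdsWithin] with z hz using (hF i z hz).symm
    · exact ((hf i _ (hs i x hx)).continuousAt.comp (p i).continuous.continuousAt).continuousWithinAt
  -- The derivative lives on `V × V` over the spaces `X i × X i`, so the domain must vary in the
  -- induction; the target family `q` stays fixed.
  induction n generalizing V X with
  | zero => exact hcont
  | succ n ih =>
    have hlim : ∀ x ∈ U, ∀ v : V, ∀ i, Tendsto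
        (fun t : ℝ => q i (t⁻¹ • (F (x + t • v) - F x))) (𝓝[≠] 0)
        (𝓝 (fderiv ℝ (f i) (p i x) (p i v))) := by
      intro x hx v i
      have h1 : HasDerivAt (fun t : ℝ => f i (p i x + t • p i v))
          (fderiv ℝ (f i) (p i x) (p i v)) 0 :=
        ((hf i _ (hs i x hx)).differentiableAt (by norm_num)).hasFDerivAt.hasLineDerivAt (p i v)
      refine h1.tendsto_slope_zero.congr' ?_
      have h2 : Tendsto (fun t : ℝ => x + t • v) (𝓝[≠] 0) (𝓝 x) := by
        have : Continuous fun t : ℝ => x + t • v :=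
          continuous_const.add (continuous_id.smul continuous_const)
        simpa using (this.tendsto 0).mono_left nhdsWithin_le_nhds
      -- The levelwise formula for `F` is available only on `U`, which contains `x + t • v` for
      -- small `t`.
      filter_upwards [h2.eventually (hU.mem_nhds hx)] with t ht
      rw [map_smul, map_sub, hF i _ ht, hF i x hx, map_add, map_smul]
      simp
    have hex : ∀ z : V × V, ∃ d : W, z.1 ∈ U →
        ∀ i, q i d = fderiv ℝ (f i) (p i z.1) (p i z.2) := by
      intro z
      by_cases hz : z.1 ∈ U
      · obtain ⟨d, hd⟩ := hq.exists_eq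
          (map (fun t : ℝ => t⁻¹ • (F (z.1 + t • z.2) - F z.1)) (𝓝[≠] 0)) _ (hlim z.1 hz z.2)
        exact ⟨d, fun _ => hd⟩
      -- The derivative is total as a function; its values off `U × V` are irrelevant.
      · exact ⟨0, fun h => absurd h hz⟩
    choose dF hdF using hex
    refine ⟨hcont, dF, fun x hx v => hq.tendsto fun i => ?_, ?_⟩
    · rw [hdF (x, v) hx]
      exact hlim x hx v i
    · have hs' : ∀ i, ∀ z ∈ U ×ˢ (univ : Set V),
          (p i).prodMap (p i) z ∈ s i ×ˢ (univ : Set (X i)) :=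
        fun i z hz => ⟨hs i z.1 hz.1, trivial⟩
      have hf' : ∀ i, ∀ z ∈ s i ×ˢ (univ : Set (X i)),
          ContDiffAt ℝ ∞ (fun z => fderiv ℝ (f i) z.1 z.2) z := fun i z hz =>
        (((hf i z.1 hz.1).fderiv_right (m := ∞) (by norm_num)).comp z
          contDiffAt_fst).clm_apply contDiffAt_snd
      have hF' : ∀ i, ∀ z ∈ U ×ˢ (univ : Set V), q i (dF z) =
          (fun z => fderiv ℝ (f i) z.1 z.2) ((p i).prodMap (p i) z) :=
        fun i z hz => hdF z hz.1 i
      refine ih (fun i => (p i).prodMap (p i)) (hU.prod isOpen_univ) hs' hf' hF' ?_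
      intro z hz
      refine hq.tendsto fun i => ?_
      rw [hF' i z hz]
      refine Tendsto.congr' (f₁ := fun z => (fun z => fderiv ℝ (f i) z.1 z.2)
        ((p i).prodMap (p i) z)) ?_ ?_
      · filter_upwards [self_mem_nhdsWithin] with y hy using (hF' i y hy).symm
      · exact ContinuousAt.continuousWithinAt (ContinuousAt.comp
          (hf' i _ (hs' i z hz)).continuousAt ((p i).prodMap (p i)).continuous.continuousAt)

namespace BanachManifold

/-! ### Limit charts -/

/-- The projection `𝔼_∞ → 𝔼ᵢ`. -/
noncomputable def evalInf (M : BanachManifold.{u, v}) (i : ℕ) : M.VecInf →L[ℝ] (M.iter i).Vec :=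
  (ContinuousLinearMap.proj i).comp M.VecInf.subtypeL

/-- The limit space has the subspace topology of a product, and its defining relations are
continuous, so they pass to coordinatewise limits by uniqueness of limits. -/
theorem isClosedFamily_evalInf (M : BanachManifold.{u, v}) : IsClosedFamily M.evalInf where
  nhds_le a := by
    rw [nhds_subtype_eq_comap, nhds_pi, Filter.pi, comap_iInf]
    simp only [comap_comap]
    exact le_rfl
  exists_eq l _ c h := by
    refine ⟨⟨c, fun i => ?_⟩, fun i => rfl⟩
    refine tendsto_nhds_unique ((((M.iter i).vecProj).continuous.tendsto _).comp (h (i + 1))) ?_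
    exact (h i).congr fun x => (x.2 i).symm

theorem mem_limChart_target_iff (M : BanachManifold.{u, v}) (α : atlas M.Model M.Carrier)
    (x : M.VecInf) : x ∈ (M.limChart α).target ↔
      ∀ i, x.1 i ∈ ((M.iter i).coord (M.iterChart α i)).target := Iff.rfl

/-- Each induced chart fills the whole fibre direction, so the conditions at higher levels follow
from the one at level zero. Openness of the image depends on this, since infinitely many open
conditions need not define an open set. -/
theorem mem_limChart_target_iff_zero (M : BanachManifold.{u, v}) (α : atlas M.Model M.Carrier)
    (x : M.VecInf) : x ∈ (M.limChart α).target ↔ x.1 0 ∈ (M.coord α).target := by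
  refine ⟨fun h => h 0, fun h i => ?_⟩
  induction i with
  | zero => exact h
  | succ i ih =>
    change x.1 (i + 1) ∈
      ((M.iter i).tangent.coord ((M.iter i).tangentChart (M.iterChart α i))).target
    rw [tangentChart_target]
    refine ⟨?_, trivial⟩
    have hx : (x.1 (i + 1)).1 = x.1 i := x.2 i
    rw [hx]
    exact ih

theorem isOpen_limChart_target (M : BanachManifold.{u, v}) (α : atlas M.Model M.Carrier) :
    IsOpen (M.limChart α).target := by
  have h : (M.limChart α).target = M.evalInf 0 ⁻¹' (M.coord α).target :=
    ext fun x => M.mem_limChart_target_iff_zero α x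
  rw [h]
  exact (M.isOpen_coord_target α).preimage (M.evalInf 0).continuous

theorem mem_limTangentChart_target_iff (M : BanachManifold.{u, v}) (α : atlas M.Model M.Carrier)
    (p : M.VecInf × M.VecInf) : p ∈ (M.limTangentChart α).target ↔
      ∀ i, (p.1.1 i, p.2.1 i) ∈
        ((M.iter i).tangent.coord ((M.iter i).tangentChart (M.iterChart α i))).target := Iff.rfl

theorem limTangentChart_target (M : BanachManifold.{u, v}) (α : atlas M.Model M.Carrier) :
    (M.limTangentChart α).target = (M.limChart α).target ×ˢ univ := by
  ext p
  rw [mem_limTangentChart_target_iff, mem_prod, mem_limChart_target_iff]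
  simp only [tangentChart_target]
  exact ⟨fun h => ⟨fun i => (h i).1, trivial⟩, fun h i => ⟨h.1 i, trivial⟩⟩

theorem limTangentChart_symm_apply (M : BanachManifold.{u, v}) (α : atlas M.Model M.Carrier)
    {p : M.VecInf × M.VecInf} (hp : p ∈ (M.limTangentChart α).target) (i : ℕ) :
    ((M.limTangentChart α).symm p).1 i =
      ((M.iter i).tangent.coord ((M.iter i).tangentChart (M.iterChart α i))).symm
        (p.1.1 i, p.2.1 i) :=
  congrArg (fun z : M.TTInf => z.1 i) (dif_pos ((M.mem_limTangentChart_target_iff α p).1 hp))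

theorem limTangentTangentChart_apply (M : BanachManifold.{u, v}) (α : atlas M.Model M.Carrier)
    {w : M.TTTInf} (hw : ∀ i, w.1 i ∈ ((M.iter i).tangent.tangent.coord
      ((M.iter i).tangent.tangentChart ((M.iter i).tangentChart (M.iterChart α i)))).source)
    (i : ℕ) :
    (((M.evalInf i).prodMap (M.evalInf i)).prodMap ((M.evalInf i).prodMap (M.evalInf i)))
      (M.limTangentTangentChart α w) = (M.iter i).tangent.tangent.coord
      ((M.iter i).tangent.tangentChart ((M.iter i).tangentChart (M.iterChart α i))) (w.1 i) :=
  congrArg (fun z : ProjLim (fun i => (M.iter i).tangent.tangent.Vec) _ => z.1 i) (dif_pos hw)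

/-! ### The limit of the iterated complete lifts -/

theorem iterLift_compat {M : BanachManifold.{u, v}}
    {S : M.tangent.Carrier → M.tangent.tangent.Carrier} (hS : M.IsSpray 0 S) (i : ℕ)
    (ξ : (M.iter (i + 1)).tangent.Carrier) :
    D (N := (M.iter i).tangent.tangent) (N' := (M.iter i).tangent)
        (D (N := (M.iter i).tangent) (N' := M.iter i) (M.iter i).proj) (M.iterLift S (i + 1) ξ) =
      M.iterLift S i (D (N := (M.iter i).tangent) (N' := M.iter i) (M.iter i).proj ξ) :=
  (hS.iterLift i).semispray.DD_proj_completeLift ξ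

/-- The limit `S^{c_∞}` of the iterated complete lifts of a spray. -/
noncomputable def limLift {M : BanachManifold.{u, v}}
    {S : M.tangent.Carrier → M.tangent.tangent.Carrier} (hS : M.IsSpray 0 S) :
    M.TTInf → M.TTTInf := ProjLim.map (M.iterLift S) (iterLift_compat hS)

/-- The bridge from the limit to the finite levels: smoothness, the local form and the limit formula
for the components are all read off from it. -/
theorem limLocalRep_limLift {M : BanachManifold.{u, v}}
    {S : M.tangent.Carrier → M.tangent.tangent.Carrier} (hS : M.IsSpray 0 S)
    (α : atlas M.Model M.Carrier) {p : M.VecInf × M.VecInf}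
    (hp : p ∈ (M.limTangentChart α).target) (i : ℕ) :
    (((M.evalInf i).prodMap (M.evalInf i)).prodMap ((M.evalInf i).prodMap (M.evalInf i)))
      (M.limLocalRep α (limLift hS) p) =
    sprayFun ((M.iter i).vertical (M.iterChart α i) (M.iterLift S i))
      ((M.evalInf i).prodMap (M.evalInf i) p) := by
  have hs : ∀ j, (((M.limTangentChart α).symm p).1 j).1 ∈
      ((M.iter j).coord (M.iterChart α j)).source := fun j => by
    rw [M.limTangentChart_symm_apply α hp]
    exact ((M.iter j).mem_tangentChart_source _ _).1 (PartialEquiv.map_target _ (hp j))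
  have h := M.limTangentTangentChart_apply α (w := limLift hS ((M.limTangentChart α).symm p))
    (fun j => (hS.iterLift j).semispray.mem_source _ (hs j)) i
  refine h.trans (((hS.iterLift i).semispray.coord_eq _ (hs i)).trans ?_)
  rw [M.limTangentChart_symm_apply α hp, PartialEquiv.right_inv _ ((M.mem_limTangentChart_target_iff α p).1 hp i)]
  rfl

theorem limLocalComponent_limLift {M : BanachManifold.{u, v}}
    {S : M.tangent.Carrier → M.tangent.tangent.Carrier} (hS : M.IsSpray 0 S)
    (α : atlas M.Model M.Carrier) {x : M.VecInf} (hx : x ∈ (M.limChart α).target)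
    (y : M.VecInf) (i : ℕ) :
    (M.limLocalComponent α (limLift hS) (x, y)).1 i =
      (M.iter i).localComponent (M.iterChart α i) (M.iterLift S i) (x.1 i, y.1 i) := by
  have hp : (x, y) ∈ (M.limTangentChart α).target := by
    rw [limTangentChart_target]; exact ⟨hx, trivial⟩
  exact congrArg (fun q => (-1 / 2 : ℝ) • q.2.2) (limLocalRep_limLift hS α hp i)

theorem limLocalRep_limLift_eq {M : BanachManifold.{u, v}}
    {S : M.tangent.Carrier → M.tangent.tangent.Carrier} (hS : M.IsSpray 0 S)
    (α : atlas M.Model M.Carrier) {x : M.VecInf} (hx : x ∈ (M.limChart α).target)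
    (y : M.VecInf) :
    M.limLocalRep α (limLift hS) (x, y) =
      ((x, y), (y, (-2 : ℝ) • M.limLocalComponent α (limLift hS) (x, y))) := by
  have hp : (x, y) ∈ (M.limTangentChart α).target := by
    rw [limTangentChart_target]; exact ⟨hx, trivial⟩
  have h := limLocalRep_limLift hS α hp
  refine Prod.ext (Prod.ext ?_ ?_) (Prod.ext ?_ ?_)
  · exact Subtype.ext (funext fun i => congrArg (fun q => q.1.1) (h i))
  · exact Subtype.ext (funext fun i => congrArg (fun q => q.1.2) (h i))
  · exact Subtype.ext (funext fun i => congrArg (fun q => q.2.1) (h i))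
  · change _ = (-2 : ℝ) • ((-1 / 2 : ℝ) • (M.limLocalRep α (limLift hS) (x, y)).2.2)
    rw [smul_smul]
    norm_num

theorem isSprayInf_limLift {M : BanachManifold.{u, v}}
    {S : M.tangent.Carrier → M.tangent.tangent.Carrier} (hS : M.IsSpray 0 S) :
    M.IsSprayInf (limLift hS) where
  semispray :=
    { continuous := Continuous.subtype_mk (continuous_pi fun i =>
        (hS.iterLift i).semispray.smooth.continuous.comp
          ((continuous_apply i).comp continuous_subtype_val)) _
      smooth := fun α n => by
        refine FrechetContDiffOn.of_projections
          (M.isClosedFamily_evalInf.prodMap.prodMap) n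
          (fun i => (M.evalInf i).prodMap (M.evalInf i)) ?_
          (s := fun i => ((M.iter i).coord (M.iterChart α i)).target ×ˢ univ) ?_ ?_
          (fun i p hp => limLocalRep_limLift hS α hp i)
        · rw [limTangentChart_target]
          exact (M.isOpen_limChart_target α).prod isOpen_univ
        · intro i p hp
          rw [limTangentChart_target] at hp
          exact ⟨hp.1 i, trivial⟩
        · intro i p hp
          exact contDiffAt_id.prodMk (contDiffAt_snd.prodMk
            ((hS.iterLift i).semispray.contDiffAt_vertical _ hp.1))
      proj_eq := fun ξ => Subtype.ext (funext fun i => (hS.iterLift i).semispray.proj_eq _)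
      Dproj_eq := fun ξ => Subtype.ext (funext fun i =>
        (hS.iterLift i).semispray.D_proj_eq _) }
  homogeneous α x hx y c := Subtype.ext (funext fun i => by
    rw [limLocalComponent_limLift hS α hx]
    refine ((hS.iterLift i).homogeneous α (x.1 i) (hx i) (y.1 i) c).trans ?_
    rw [← limLocalComponent_limLift hS α hx]
    rfl)

end BanachManifold

theorem mainTheorem7 (M : BanachManifold.{u, v}) :
    (∀ (i : ℕ) (S : (M.iter i).tangent.Carrier → (M.iter i).tangent.tangent.Carrier),
      M.IsSpray i S → M.IsSpray (i + 1) ((M.iter i).completeLift S)) ∧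
    (∀ S : M.tangent.Carrier → M.tangent.tangent.Carrier, M.IsSpray 0 S →
      ∃ hlim : ∀ (i : ℕ) (ξ : (M.iter (i + 1)).tangent.Carrier),
          BanachManifold.D (N := (M.iter i).tangent.tangent) (N' := (M.iter i).tangent)
              (BanachManifold.D (N := (M.iter i).tangent) (N' := M.iter i) (M.iter i).proj)
              (M.iterLift S (i + 1) ξ) =
            M.iterLift S i
              (BanachManifold.D (N := (M.iter i).tangent) (N' := M.iter i) (M.iter i).proj ξ),
        let Sinf : M.TTInf → M.TTTInf := ProjLim.map (M.iterLift S) hlim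
        M.IsSprayInf Sinf ∧
        ∀ (α : atlas M.Model M.Carrier), ∀ x ∈ (M.limChart α).target, ∀ y : M.VecInf,
          M.limLocalRep α Sinf (x, y) =
            ((x, y), (y, (-2 : ℝ) • M.limLocalComponent α Sinf (x, y))) ∧
          ∀ i : ℕ, (M.limLocalComponent α Sinf (x, y)).1 i =
            (M.iter i).localComponent (M.iterChart α i) (M.iterLift S i) (x.1 i, y.1 i)) := by
  refine ⟨fun i S hS => hS.completeLift, fun S hS =>
    ⟨BanachManifold.iterLift_compat hS, BanachManifold.isSprayInf_limLift hS, ?_⟩⟩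
  exact fun α x hx y => ⟨BanachManifold.limLocalRep_limLift_eq hS α hx y,
    BanachManifold.limLocalComponent_limLift hS α hx y⟩
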